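/- Let $\mathbf X,\mathbf Y$ be finite sets and $f:\mathbf X\times\mathbf Y\to\{-1,1\}$. Let $CC(f,p)$ be the minimum $c$ for which there is a one-way classical protocol with shared randomness in which Alice, knowing $x$, sends $c$ bits to Bob, and Bob, knowing $y$, then outputs $f(x,y)$ with probability larger than $p$, for every input $(x,y)$. Let $QC(f,p)$ be the analogous minimum when Alice sends $c$ qubits, i.e. a state of dimension $2^c$, which Bob measures (shared randomness is allowed, shared entanglement is not). For a Bell functional $B=(B_{a,b,x,y})$ with finitely many inputs and outputs and a family of joint distributions $P=(P(a,b|x,y))$ put $\langle B,P\rangle=\sum_{a,b,x,y}B_{a,b,x,y}P(a,b|x,y)$. Let $\omega(B)=\sup_{P\in\mathcal L}|\langle B,P\rangle|$ and $\omega^*(B)=\sup_{P\in\mathcal Q}|\langle B,P\rangle|$, where $\mathcal L$ is the set of classical distributions $P(a,b|x,y)=\int_\Omega P_\omega(a|x)Q_\omega(b|y)\,d\mathbb P(\omega)$ and $\mathcal Q$ is the set of quantum distributions $P(a,b|x,y)=\mathrm{tr}\big((E_x^a\otimes F_y^b)\rho\big)$, with $\rho$ a density operator on a tensor product $H_1\otimes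 H_2$ of Hilbert spaces and $(E_x^a)_a$, $(F_y^b)_b$ POVMs on $H_1$ and $H_2$. An XOR game $G=(f,\pi)$ is a function $f$ as above together with a probability distribution $\pi$ on $\mathbf X\times\mathbf Y$. For a natural number $n$, $B^G_n$ is the Bell functional with inputs $x\in\mathbf X$ for Alice and $(y,k)\in\mathbf Y\times\{1,\dots,n\}$ for Bob, outputs $(a,\tilde a)\in\{1,\dots,n\}\times\{-1,1\}$ for Alice and $b\in\{-1,1\}$ for Bob, and coefficients $$B^G_n(a,\tilde a,b,x,y,k)=\pi(x,y)\,f(x,y)\,\delta_{a,k}\,\tilde a\,b .$$ **Theorem.** Let $\alpha>216$ and suppose that $$\frac{CC(f,\frac23)}{QC(f,\frac23)}>\alpha .$$ Then there is a probability distribution $\pi$ on $\mathbf X\times\mathbf Y$ such that, with $c=QC(f,\frac23)$, $d=2^c$ and $G=(f,\pi)$, $$\frac{\omega^*(B^G_{d^2})}{\omega(B^G_{d^2})}\ \ge\ \frac{\sqrt\alpha}{6\sqrt6}.$$ -/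

import Mathlib

open scoped BigOperators TensorProduct InnerProductSpace ComplexOrder

noncomputable section

namespace OneWay

/-! ## Bell functionals and their values -/

/-- A Bell functional: real coefficients `B a b x y`. -/
abbrev BellFunctional (X Y A B : Type*) := A → B → X → Y → ℝ

/-- `P a b x y` is to be read as `P(a, b | x, y)`: a family of joint probability distributions
of the outputs `(a, b)`, one for each pair of inputs `(x, y)`. -/
def IsBipartiteDistribution {X Y A B : Type*} [Fintype A] [Fintype B]
    (P : A → B → X → Y → ℝ) : Prop :=
  (∀ a b x y, 0 ≤ P a b x y) ∧ ∀ x y, ∑ a, ∑ b, P a b x y = 1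

/-- The action `⟨B, P⟩ = ∑ B(a,b,x,y) P(a,b|x,y)` of a Bell functional. -/
def BellFunctional.pairing {X Y A B : Type*} [Fintype X] [Fintype Y] [Fintype A] [Fintype B]
    (M : BellFunctional X Y A B) (P : A → B → X → Y → ℝ) : ℝ :=
  ∑ a, ∑ b, ∑ x, ∑ y, M a b x y * P a b x y

/-- A local (classical) strategy: shared randomness `ω` in a probability space, and local response
probabilities `p ω x a = P_ω(a|x)` and `q ω y b = Q_ω(b|y)`. -/
structure LocalStrategy (X Y A B : Type*) [Fintype A] [Fintype B] where
  Ω : Type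
  [mΩ : MeasurableSpace Ω]
  μ : MeasureTheory.Measure Ω
  [prob : MeasureTheory.IsProbabilityMeasure μ]
  p : Ω → X → A → ℝ
  q : Ω → Y → B → ℝ
  p_meas : ∀ x a, Measurable fun ω => p ω x a
  q_meas : ∀ y b, Measurable fun ω => q ω y b
  p_nonneg : ∀ ω x a, 0 ≤ p ω x a
  q_nonneg : ∀ ω y b, 0 ≤ q ω y b
  p_sum : ∀ ω x, ∑ a, p ω x a = 1
  q_sum : ∀ ω y, ∑ b, q ω y b = 1

attribute [instance] LocalStrategy.mΩ LocalStrategy.prob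

/-- The set `𝓛` of classical bipartite probability distributions. -/
def classicalSet (X Y A B : Type*) [Fintype A] [Fintype B] : Set (A → B → X → Y → ℝ) :=
  {P | IsBipartiteDistribution P ∧ ∃ S : LocalStrategy X Y A B,
    ∀ a b x y, P a b x y = ∫ ω, S.p ω x a * S.q ω y b ∂S.μ}

/-- The Hilbert space tensor product of two Hilbert spaces (completion of the algebraic one). -/
abbrev HilbertTensor (H K : Type*) [NormedAddCommGroup H] [InnerProductSpace ℂ H]
    [NormedAddCommGroup K] [InnerProductSpace ℂ K] : Type _ :=
  UniformSpace.Completion (H ⊗[ℂ] K)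

/-- The bounded operator `E ⊗ F` on the Hilbert space tensor product. -/
def tensorOp {H K : Type*} [NormedAddCommGroup H] [InnerProductSpace ℂ H]
    [NormedAddCommGroup K] [InnerProductSpace ℂ K] (E : H →L[ℂ] H) (F : K →L[ℂ] K) :
    HilbertTensor H K →L[ℂ] HilbertTensor H K :=
  (TensorProduct.mapL E F).completion

/-- A quantum strategy: Hilbert spaces `H₁`, `H₂` (of any dimension), a density operator `ρ` on
`H₁ ⊗ H₂` (a positive operator whose trace, computed in the Hilbert basis `basis`, is `1`), and
POVMs `E x` on `H₁` and `F y` on `H₂` for all inputs. The traces below do not depend on the choice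
of `basis`, as `ρ` is positive and of trace class. -/
structure QuantumStrategy (X Y A B : Type*) [Fintype A] [Fintype B] where
  H₁ : Type
  H₂ : Type
  [grp₁ : NormedAddCommGroup H₁]
  [grp₂ : NormedAddCommGroup H₂]
  [inner₁ : InnerProductSpace ℂ H₁]
  [inner₂ : InnerProductSpace ℂ H₂]
  [complete₁ : CompleteSpace H₁]
  [complete₂ : CompleteSpace H₂]
  ι : Type
  basis : HilbertBasis ι ℂ (HilbertTensor H₁ H₂)
  ρ : HilbertTensor H₁ H₂ →L[ℂ] HilbertTensor H₁ H₂
  ρ_pos : ρ.IsPositive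
  ρ_trace : HasSum (fun i => ⟪basis i, ρ (basis i)⟫_ℂ) 1
  E : X → A → H₁ →L[ℂ] H₁
  F : Y → B → H₂ →L[ℂ] H₂
  E_pos : ∀ x a, (E x a).IsPositive
  F_pos : ∀ y b, (F y b).IsPositive
  E_sum : ∀ x, ∑ a, E x a = ContinuousLinearMap.id ℂ H₁
  F_sum : ∀ y, ∑ b, F y b = ContinuousLinearMap.id ℂ H₂

attribute [instance] QuantumStrategy.grp₁ QuantumStrategy.grp₂ QuantumStrategy.inner₁
  QuantumStrategy.inner₂ QuantumStrategy.complete₁ QuantumStrategy.complete₂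

/-- The set `𝓠` of quantum bipartite probability distributions, those of the form
`P(a,b|x,y) = tr((E_x^a ⊗ F_y^b) ρ)`. -/
def quantumSet (X Y A B : Type*) [Fintype A] [Fintype B] : Set (A → B → X → Y → ℝ) :=
  {P | IsBipartiteDistribution P ∧ ∃ S : QuantumStrategy X Y A B, ∀ a b x y,
    HasSum (fun i => ⟪S.basis i, tensorOp (S.E x a) (S.F y b) (S.ρ (S.basis i))⟫_ℂ)
      (P a b x y : ℂ)}

/-- The classical value `ω(B) = sup_{P ∈ 𝓛} |⟨B, P⟩|`. -/
def BellFunctional.classicalValue {X Y A B : Type*} [Fintype X] [Fintype Y] [Fintype A] [Fintype B]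
    (M : BellFunctional X Y A B) : ℝ :=
  sSup ((fun P => |M.pairing P|) '' classicalSet X Y A B)

/-- The quantum value `ω*(B) = sup_{P ∈ 𝓠} |⟨B, P⟩|`. -/
def BellFunctional.quantumValue {X Y A B : Type*} [Fintype X] [Fintype Y] [Fintype A] [Fintype B]
    (M : BellFunctional X Y A B) : ℝ :=
  sSup ((fun P => |M.pairing P|) '' quantumSet X Y A B)

/-! ## XOR games and the associated Bell functional; signs `±1` are elements of `ℤˣ` -/

/-- An XOR game `G = (f, π)`: a sign function and a probability distribution on the inputs. -/
structure XORGame (X Y : Type*) [Fintype X] [Fintype Y] where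
  f : X → Y → ℤˣ
  π : X → Y → ℝ
  π_nonneg : ∀ x y, 0 ≤ π x y
  π_sum : ∑ x, ∑ y, π x y = 1

/-- The coefficients `T x y = π(x,y) f(x,y)` of an XOR game. -/
def XORGame.coeff {X Y : Type*} [Fintype X] [Fintype Y] (G : XORGame X Y) (x : X) (y : Y) : ℝ :=
  G.π x y * ((G.f x y : ℤ) : ℝ)

/-- The Bell functional `B^G_d`: inputs `x` for Alice and `(y, k)` for Bob, outputs `(a, ã)` for
Alice and `b` for Bob, where `a, k` range over `d` values and `ã, b` are signs. -/
def XORGame.bell {X Y : Type*} [Fintype X] [Fintype Y] (G : XORGame X Y) (d : ℕ) :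
    BellFunctional X (Y × Fin d) (Fin d × ℤˣ) ℤˣ :=
  fun a b x y => G.coeff x y.1 * (if a.1 = y.2 then 1 else 0) * ((a.2 : ℤ) : ℝ) * ((b : ℤ) : ℝ)

/-! ## One-way communication complexity -/

/-- A one-way classical protocol with `c` bits: from `x` and the shared randomness `l`, Alice
computes a message in a set of size `2 ^ c`; from `y`, `l` and the message Bob computes the
output. -/
structure ClassicalProtocol (X Y : Type*) (c : ℕ) where
  Λ : Type
  [mΛ : MeasurableSpace Λ]
  μ : MeasureTheory.Measure Λ
  [prob : MeasureTheory.IsProbabilityMeasure μ]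
  msg : X → Λ → Fin (2 ^ c)
  out : Y → Λ → Fin (2 ^ c) → ℤˣ
  msg_meas : ∀ x m, MeasurableSet {l | msg x l = m}
  out_meas : ∀ y m s, MeasurableSet {l | out y l m = s}

attribute [instance] ClassicalProtocol.mΛ ClassicalProtocol.prob

/-- The probability that Bob outputs `s` on inputs `x`, `y`. -/
def ClassicalProtocol.outputProb {X Y : Type*} {c : ℕ} (P : ClassicalProtocol X Y c)
    (x : X) (y : Y) (s : ℤˣ) : ℝ :=
  P.μ.real {l | P.out y l (P.msg x l) = s}

/-- `CC(f, p)`: the least number of bits of a one-way classical protocol (with shared randomness)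
which computes `f` with probability larger than `p` on every input. -/
def CC {X Y : Type*} (f : X → Y → ℤˣ) (p : ℝ) : ℕ :=
  sInf {c | ∃ P : ClassicalProtocol X Y c, ∀ x y, p < P.outputProb x y (f x y)}

/-- A one-way quantum protocol with `c` qubits: from `x` and the shared randomness `l`, Alice
prepares a state `state x l` of dimension `2 ^ c` and sends it to Bob, who measures it with the
two-outcome POVM `meas y l` and outputs the result. No entanglement is shared beforehand. -/
structure QuantumProtocol (X Y : Type*) (c : ℕ) where
  Λ : Type
  [mΛ : MeasurableSpace Λ]
  μ : MeasureTheory.Measure Λ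
  [prob : MeasureTheory.IsProbabilityMeasure μ]
  state : X → Λ → Matrix (Fin (2 ^ c)) (Fin (2 ^ c)) ℂ
  meas : Y → Λ → ℤˣ → Matrix (Fin (2 ^ c)) (Fin (2 ^ c)) ℂ
  state_meas : ∀ x i j, Measurable fun l => state x l i j
  meas_meas : ∀ y s i j, Measurable fun l => meas y l s i j
  state_pos : ∀ x l, (state x l).PosSemidef
  state_trace : ∀ x l, (state x l).trace = 1
  meas_pos : ∀ y l s, (meas y l s).PosSemidef
  meas_sum : ∀ y l, ∑ s, meas y l s = 1

attribute [instance] QuantumProtocol.mΛ QuantumProtocol.prob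

/-- The probability that Bob outputs `s` on inputs `x`, `y`. -/
def QuantumProtocol.outputProb {X Y : Type*} {c : ℕ} (P : QuantumProtocol X Y c)
    (x : X) (y : Y) (s : ℤˣ) : ℝ :=
  ∫ l, (P.meas y l s * P.state x l).trace.re ∂P.μ

/-- `QC(f, p)`: the least number of qubits of a one-way quantum protocol (with shared randomness,
without shared entanglement) which computes `f` with probability larger than `p` on every input. -/
def QC {X Y : Type*} (f : X → Y → ℤˣ) (p : ℝ) : ℕ :=
  sInf {c | ∃ P : QuantumProtocol X Y c, ∀ x y, p < P.outputProb x y (f x y)}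

end OneWay

end

/-! ### Minimax and amplification by majority -/

namespace OneWay

/-! The functional `XORGame.bell` scores only when Alice's first output equals Bob's input `k`. A
deterministic strategy is thus scored like a one-way protocol in which Bob learns Alice's pair
(value, sign): for `d² = 2 ^ (2c)` values that is a message of `2c + 1` bits, and the score is the
bias of this protocol under `π`.

Put `ε = 2√6/√α` and apply minimax (`exists_mixed_strategy_or`). If a mixture of deterministic
strategies had bias at least `ε` on every input, a majority vote over `t = ⌊α/3⌋` copies would err
with probability below `1/3` by Chebyshev, since `t ε² > 3` (`CC_le_of_mixed_strategy`). Then `CC ≤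
(2c + 1) t ≤ α c`, against the hypothesis. So some `π` keeps every deterministic strategy below `ε`,
and derandomization gives `ω ≤ ε` (`classicalValue_bell_mem_Ioc`).

On the quantum side `ω* ≥ 1/3` for every `π` (`one_third_le_quantumValue`). A `c`-qubit protocol has
bias above `1/3`; measuring half of a maximally entangled state steers Bob's half to the message
state, up to a Weyl unitary labelled by one of `d²` outcomes. Given the label as his input `k`, Bob
undoes the unitary, and no score is lost. The quotient is at least `1/(3ε) = √α/(6√6)`. -/

/-- Von Neumann's minimax theorem for a finite zero-sum game with payoffs `M s i`, as an
alternative between a good mixed strategy of one player and one of the other. -/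
theorem exists_mixed_strategy_or {S I : Type*} [Fintype S] [Fintype I] [Nonempty S]
    (M : S → I → ℝ) (ε : ℝ) :
    (∃ q ∈ stdSimplex ℝ S, ∀ i, ε ≤ ∑ s, q s * M s i) ∨
      ∃ p ∈ stdSimplex ℝ I, ∀ s, ∑ i, p i * M s i < ε := by
  classical
  rw [or_iff_not_imp_left]
  intro hno
  let L : (S → ℝ) →ₗ[ℝ] (I → ℝ) := (Matrix.of M).vecMulLinear
  have hL : ∀ q i, L q i = ∑ s, q s * M s i := fun q i => rfl
  have hdisj : Disjoint (L '' stdSimplex ℝ S) (Set.Ici fun _ => ε) := by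
    rw [Set.disjoint_left]
    rintro _ ⟨q, hq, rfl⟩ hε
    exact hno ⟨q, hq, fun i => hL q i ▸ hε i⟩
  -- Separate the achievable payoff vectors from the orthant of vectors that are at least `ε`; the
  -- normalized separating functional is the opponent's mixed strategy.
  obtain ⟨φ, u, v, hu, huv, hv⟩ := geometric_hahn_banach_compact_closed
    ((convex_stdSimplex ℝ S).linear_image L)
    ((isCompact_stdSimplex ℝ S).image L.continuous_of_finiteDimensional)
    (convex_Ici _) isClosed_Ici hdisj
  let w : I → ℝ := fun i => φ (Pi.single i 1)
  have hφ : ∀ z : I → ℝ, φ z = ∑ i, z i * w i := by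
    intro z
    conv_lhs => rw [← Finset.univ_sum_single z, map_sum]
    refine Finset.sum_congr rfl fun i _ => ?_
    have : Pi.single i (z i) = z i • (Pi.single i 1 : I → ℝ) := by
      rw [← Pi.single_smul, smul_eq_mul, mul_one]
    rw [this, map_smul, smul_eq_mul]
  have hw : ∀ i, 0 ≤ w i := by
    intro i
    by_contra! hi
    -- A negative weight would let `φ` fall to `v` far along the `i`-th axis of the orthant.
    set t : ℝ := max 0 ((v - φ fun _ => ε) / w i) with ht
    have h1 := hv ((fun _ => ε) + t • Pi.single i 1) (by
      intro j
      have : (0 : ℝ) ≤ (Pi.single i 1 : I → ℝ) j := by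
        by_cases h : j = i
        · subst h; simp
        · simp [Pi.single_eq_of_ne h]
      simpa using mul_nonneg (le_max_left _ _) this)
    have h2 : φ ((fun _ => ε) + t • Pi.single i 1) = φ (fun _ => ε) + t * w i := by
      rw [map_add, map_smul, smul_eq_mul]
    have h3 : (v - φ fun _ => ε) / w i ≤ t := le_max_right _ _
    rw [div_le_iff_of_neg hi] at h3
    linarith
  obtain ⟨s₀⟩ := ‹Nonempty S›
  have hrow : ∀ s, φ (M s) < u := fun s => hu _
    ⟨Pi.single s 1, single_mem_stdSimplex ℝ s, by
      ext i; rw [hL]; simp [Pi.single_apply]⟩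
  have hε : v < φ fun _ => ε := hv _ (Set.mem_Ici.2 le_rfl)
  have hW : 0 < ∑ i, w i := by
    refine lt_of_le_of_ne (Finset.sum_nonneg fun i _ => hw i) fun h0 => ?_
    have hz : ∀ i, w i = 0 := fun i =>
      (Finset.sum_eq_zero_iff_of_nonneg fun i _ => hw i).1 h0.symm i (Finset.mem_univ _)
    have := hrow s₀
    rw [hφ] at this hε
    simp only [hz, mul_zero, Finset.sum_const_zero] at this hε
    linarith
  refine ⟨fun i => w i / ∑ i, w i, ⟨fun i => div_nonneg (hw i) hW.le, ?_⟩, fun s => ?_⟩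
  · rw [← Finset.sum_div, div_self hW.ne']
  · have h1 : ∑ i, M s i * w i < ∑ i, ε * w i := by
      rw [← hφ, ← hφ fun _ => ε]; linarith [hrow s]
    rw [← Finset.mul_sum] at h1
    have : ∑ i, w i / (∑ i, w i) * M s i = (∑ i, M s i * w i) / ∑ i, w i := by
      rw [Finset.sum_div]; exact Finset.sum_congr rfl fun i _ => by ring
    rw [this, div_lt_iff₀ hW]
    exact h1

/-- Sign of an integer, with `0` sent to `-1`. -/
def majority (n : ℤ) : ℤˣ := if 0 < n then 1 else -1

/-- Ties are counted as errors in the Chebyshev bound, so the value at `0` is immaterial. -/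
theorem majority_eq_of_pos {n : ℤ} (s : ℤˣ) (h : 0 < (s : ℤ) * n) : majority n = s := by
  rcases Int.units_eq_one_or s with rfl | rfl <;> simp [majority] at h ⊢ <;> omega

open MeasureTheory ProbabilityTheory in
/-- Chebyshev bound for a sum of `t` independent copies of a variable in `[-1, 1]` of mean at
least `ε`. -/
theorem real_sum_nonpos_lt {Ω : Type*} [MeasurableSpace Ω] (μ : Measure Ω) [IsProbabilityMeasure μ]
    {Z : Ω → ℝ} (hZ : Measurable Z) (hb : ∀ ω, Z ω ∈ Set.Icc (-1) 1) {ε : ℝ} (hε : 0 < ε)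
    (hmean : ε ≤ ∫ ω, Z ω ∂μ) {t : ℕ} (ht : 3 < t * ε ^ 2) :
    (Measure.pi fun _ : Fin t => μ).real {ω | ∑ i, Z (ω i) ≤ 0} < 1 / 3 := by
  have ht0 : 0 < (t : ℝ) := by
    by_contra! h
    nlinarith [sq_nonneg ε]
  have hL : MemLp Z 2 μ := MemLp.of_bound hZ.aestronglyMeasurable 1
    (.of_forall fun ω => by rw [Real.norm_eq_abs, abs_le]; exact hb ω)
  set ν := Measure.pi fun _ : Fin t => μ with hν
  set m := ∫ ω, Z ω ∂μ with hm
  have hmp : ∀ i : Fin t, MeasurePreserving (fun ω : Fin t → Ω => ω i) ν μ := fun i =>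
    measurePreserving_eval (fun _ => μ) i
  have hLi : ∀ i : Fin t, MemLp (fun ω : Fin t → Ω => Z (ω i)) 2 ν := fun i =>
    hL.comp_measurePreserving (hmp i)
  have hS : MemLp (∑ i, fun ω : Fin t → Ω => Z (ω i)) 2 ν := memLp_finsetSum' _ fun i _ => hLi i
  have hvar : Var[∑ i, fun ω : Fin t → Ω => Z (ω i); ν] ≤ t := by
    rw [hν, variance_sum_pi (μ := fun _ : Fin t => μ) (X := fun _ => Z) fun _ => hL]
    calc ∑ _i : Fin t, Var[Z; μ] ≤ ∑ _i : Fin t, (1 : ℝ) := by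
          refine Finset.sum_le_sum fun i _ => ?_
          have := variance_le_sq_of_bounded (μ := μ) (.of_forall hb) hZ.aemeasurable
          norm_num at this; exact this
      _ = t := by simp
  have hE : ∫ ω, (∑ i, fun ω : Fin t → Ω => Z (ω i)) ω ∂ν = t * m := by
    simp only [Finset.sum_apply]
    rw [integral_finsetSum _ fun i _ => (hLi i).integrable (by norm_num)]
    have : ∀ i : Fin t, ∫ ω, Z (ω i) ∂ν = m := fun i => by
      rw [hm, ← (hmp i).map_eq, integral_map (hmp i).measurable.aemeasurable
        hZ.aestronglyMeasurable]
    simp [this]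
  have hc : 0 < t * m := mul_pos ht0 (hε.trans_le hmean)
  have hch := meas_ge_le_variance_div_sq hS hc
  rw [hE] at hch
  have hsub : {ω : Fin t → Ω | ∑ i, Z (ω i) ≤ 0} ⊆
      {ω | t * m ≤ |(∑ i, fun ω : Fin t → Ω => Z (ω i)) ω - t * m|} := by
    intro ω hω
    simp only [Set.mem_ofPred_eq, Finset.sum_apply] at hω ⊢
    rw [abs_of_nonpos (by linarith)]
    linarith
  calc ν.real {ω | ∑ i, Z (ω i) ≤ 0}
      ≤ Var[∑ i, fun ω : Fin t → Ω => Z (ω i); ν] / (t * m) ^ 2 :=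
        ENNReal.toReal_le_of_le_ofReal (div_nonneg (variance_nonneg _ _) (sq_nonneg _))
          ((measure_mono hsub).trans hch)
    _ ≤ t / (t * m) ^ 2 := by gcongr
    _ = 1 / (t * m ^ 2) := by field_simp
    _ < 1 / 3 := by
      apply one_div_lt_one_div_of_lt (by norm_num)
      have : ε ^ 2 ≤ m ^ 2 := by gcongr
      nlinarith

end OneWay

/-! ### Classical protocols from mixed strategies -/

namespace OneWay

open MeasureTheory

/-- Deterministic strategies for the Bell functional `XORGame.bell` with `n` values. -/
abbrev DetStrategy (X Y : Type*) (n : ℕ) := (X → Fin n × ℤˣ) × (Y × Fin n → ℤˣ)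

/-- The sign with which a deterministic strategy answers. -/
def DetStrategy.answer {X Y : Type*} {n : ℕ} (s : DetStrategy X Y n) (x : X) (y : Y) : ℤˣ :=
  (s.1 x).2 * s.2 (y, (s.1 x).1)

/-- A mixture of deterministic strategies with `n` values which is correlated with `f` on every
input yields, by independent repetition and a majority vote, a one-way protocol for `f`. -/
theorem CC_le_of_mixed_strategy {X Y : Type*} (f : X → Y → ℤˣ) {n b t : ℕ}
    (hn : n * 2 = 2 ^ b) {ε : ℝ}
    (hε : 0 < ε) (ht : 3 < t * ε ^ 2) [Fintype (DetStrategy X Y n)]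
    {q : DetStrategy X Y n → ℝ} (hq : q ∈ stdSimplex ℝ (DetStrategy X Y n))
    (hbias : ∀ x y, ε ≤ ∑ s : DetStrategy X Y n, q s * ((f x y * s.answer x y : ℤˣ) : ℤ)) :
    CC f (2 / 3) ≤ b * t := by
  let N := Fintype.card (DetStrategy X Y n)
  let e : Fin N ≃ DetStrategy X Y n := (Fintype.equivFin _).symm
  -- All `t` outputs of Alice form one message; each takes `n * 2 = 2 ^ b` values.
  let enc : (Fin t → Fin n × ℤˣ) ≃ Fin (2 ^ (b * t)) :=
    Fintype.equivFinOfCardEq (by simp [hn, pow_mul])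
  have hsum : ∑ i, q (e i) = 1 := by rw [e.sum_comp]; exact hq.2
  let P₀ : PMF (Fin N) := PMF.ofFintype (fun i => ENNReal.ofReal (q (e i))) (by
    rw [← ENNReal.ofReal_sum_of_nonneg fun i _ => hq.1 _, hsum, ENNReal.ofReal_one])
  let Pr : ClassicalProtocol X Y (b * t) :=
    { Λ := Fin t → Fin N
      μ := Measure.pi fun _ => P₀.toMeasure
      msg := fun x l => enc fun i => (e (l i)).1 x
      -- The message supplies the input `k` that Bob's part of each strategy needs.
      out := fun y l m => majority (∑ i, (((enc.symm m i).2 *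
        (e (l i)).2 (y, (enc.symm m i).1) : ℤˣ) : ℤ))
      msg_meas := fun _ _ => (Set.toFinite _).measurableSet
      out_meas := fun _ _ _ => (Set.toFinite _).measurableSet }
  refine Nat.sInf_le ⟨Pr, fun x y => ?_⟩
  let Z : Fin N → ℝ := fun i => (((f x y * (e i).answer x y : ℤˣ) : ℤ) : ℝ)
  have hZ : ∀ i, Z i ∈ Set.Icc (-1) 1 := by
    intro i
    simp only [Z]
    rcases Int.units_eq_one_or (f x y * (e i).answer x y) with h | h <;> rw [h] <;> simp
  have hmean : ε ≤ ∫ i, Z i ∂P₀.toMeasure := by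
    rw [PMF.integral_eq_sum]
    refine (hbias x y).trans_eq ?_
    rw [← e.sum_comp]
    refine Finset.sum_congr rfl fun i _ => ?_
    simp [P₀, Z, ENNReal.toReal_ofReal (hq.1 (e i))]
  have hlt := real_sum_nonpos_lt P₀.toMeasure (measurable_of_finite Z) hZ hε hmean ht
  have hsub : {l : Fin t → Fin N | ∑ i, Z (l i) ≤ 0}ᶜ ⊆
      {l | Pr.out y l (Pr.msg x l) = f x y} := by
    intro l hl
    simp only [Set.mem_compl_iff, Set.mem_ofPred_eq, not_le] at hl ⊢
    refine majority_eq_of_pos _ ?_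
    have : (0 : ℤ) < ∑ i, ((f x y * (e (l i)).answer x y : ℤˣ) : ℤ) := by
      have h2 : ((∑ i, ((f x y * (e (l i)).answer x y : ℤˣ) : ℤ) : ℤ) : ℝ) = ∑ i, Z (l i) := by
        push_cast [Z]; rfl
      exact_mod_cast h2 ▸ hl
    rw [Finset.mul_sum]
    simpa [Pr, DetStrategy.answer] using this
  calc (2 / 3 : ℝ) < 1 - Pr.μ.real {l | ∑ i, Z (l i) ≤ 0} := by linarith
    _ = Pr.μ.real {l | ∑ i, Z (l i) ≤ 0}ᶜ :=
      (probReal_compl_eq_one_sub (Set.toFinite _).measurableSet).symm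
    _ ≤ Pr.outputProb x y (f x y) := measureReal_mono hsub

/-! ### The classical value of the Bell functional -/

section ClassicalValue

variable {X Y A B : Type*} [Fintype X] [Fintype Y] [Fintype A] [Fintype B]

theorem exists_sum_mul_le_of_sum_eq_one {w : A → ℝ} (c : A → ℝ) (h0 : ∀ a, 0 ≤ w a)
    (h1 : ∑ a, w a = 1) : ∃ a, ∑ a, c a * w a ≤ c a := by
  by_contra! h
  have hne : Nonempty A := by
    by_contra hA
    rw [not_nonempty_iff] at hA
    simp at h1
  obtain ⟨a, ha⟩ : ∃ a, w a ≠ 0 := by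
    by_contra! hw
    simp [hw] at h1
  have : ∑ a, c a * w a < ∑ a, (∑ a', c a' * w a') * w a :=
    Finset.sum_lt_sum (fun a _ => mul_le_mul_of_nonneg_right (h a).le (h0 a))
      ⟨a, Finset.mem_univ _, mul_lt_mul_of_pos_right (h a) (lt_of_le_of_ne (h0 a) ha.symm)⟩
  rw [← Finset.mul_sum, h1, mul_one] at this
  exact this.false

/-- Derandomization: local response probabilities do no better than deterministic responses. -/
theorem exists_det_response_ge (M : BellFunctional X Y A B) {p : X → A → ℝ} {q : Y → B → ℝ}
    (hp : ∀ x a, 0 ≤ p x a) (hq : ∀ y b, 0 ≤ q y b) (hp1 : ∀ x, ∑ a, p x a = 1)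
    (hq1 : ∀ y, ∑ b, q y b = 1) :
    ∃ (g : X → A) (h : Y → B),
      ∑ a, ∑ b, ∑ x, ∑ y, M a b x y * (p x a * q y b) ≤ ∑ x, ∑ y, M (g x) (h y) x y := by
  -- Alice's best response to Bob's `q` is fixed first, then Bob's best response to `g`.
  choose g hg using fun x => exists_sum_mul_le_of_sum_eq_one
    (fun a => ∑ b, ∑ y, M a b x y * q y b) (hp x) (hp1 x)
  choose h hh using fun y => exists_sum_mul_le_of_sum_eq_one
    (fun b => ∑ x, M (g x) b x y) (hq y) (hq1 y)
  refine ⟨g, h, ?_⟩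
  calc ∑ a, ∑ b, ∑ x, ∑ y, M a b x y * (p x a * q y b)
      = ∑ x, ∑ a, (∑ b, ∑ y, M a b x y * q y b) * p x a := by
        refine ((Finset.sum_congr rfl fun a _ => Finset.sum_comm).trans Finset.sum_comm).trans
          (Finset.sum_congr rfl fun x _ => Finset.sum_congr rfl fun a _ => ?_)
        simp_rw [Finset.sum_mul]
        exact Finset.sum_congr rfl fun b _ => Finset.sum_congr rfl fun y _ => by ring
    _ ≤ ∑ x, ∑ b, ∑ y, M (g x) b x y * q y b := Finset.sum_le_sum fun x _ => hg x
    _ = ∑ y, ∑ b, (∑ x, M (g x) b x y) * q y b := by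
        refine ((Finset.sum_congr rfl fun x _ => Finset.sum_comm).trans Finset.sum_comm).trans
          (Finset.sum_congr rfl fun y _ => Finset.sum_comm.trans ?_)
        simp_rw [Finset.sum_mul]
    _ ≤ ∑ y, ∑ x, M (g x) (h y) x y := Finset.sum_le_sum fun y _ => hh y
    _ = _ := Finset.sum_comm

theorem pairing_neg (M : BellFunctional X Y A B) (P : A → B → X → Y → ℝ) :
    BellFunctional.pairing (fun a b x y => -M a b x y) P = -M.pairing P := by
  simp [BellFunctional.pairing]

theorem pairing_le_of_det (M : BellFunctional X Y A B) {ε : ℝ}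
    (hM : ∀ (g : X → A) (h : Y → B), ∑ x, ∑ y, M (g x) (h y) x y ≤ ε)
    {P : A → B → X → Y → ℝ} (hP : P ∈ classicalSet X Y A B) : M.pairing P ≤ ε := by
  obtain ⟨-, S, hS⟩ := hP
  have hp1 : ∀ ω x a, S.p ω x a ≤ 1 := fun ω x a => by
    rw [← S.p_sum ω x]
    exact Finset.single_le_sum (fun a _ => S.p_nonneg ω x a) (Finset.mem_univ a)
  have hq1 : ∀ ω y b, S.q ω y b ≤ 1 := fun ω y b => by
    rw [← S.q_sum ω y]
    exact Finset.single_le_sum (fun b _ => S.q_nonneg ω y b) (Finset.mem_univ b)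
  have hint : ∀ a b x y, Integrable (fun ω => M a b x y * (S.p ω x a * S.q ω y b)) S.μ := by
    intro a b x y
    refine Integrable.const_mul (Integrable.of_bound
      ((S.p_meas x a).mul (S.q_meas y b)).aestronglyMeasurable 1 (.of_forall fun ω => ?_)) _
    rw [Pi.mul_apply, Real.norm_of_nonneg (mul_nonneg (S.p_nonneg ω x a) (S.q_nonneg ω y b))]
    exact mul_le_one₀ (hp1 ω x a) (S.q_nonneg ω y b) (hq1 ω y b)
  have heq : M.pairing P =
      ∫ ω, ∑ a, ∑ b, ∑ x, ∑ y, M a b x y * (S.p ω x a * S.q ω y b) ∂S.μ := by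
    simp only [BellFunctional.pairing, hS]
    rw [integral_finsetSum _ fun a _ => integrable_finsetSum _ fun b _ =>
      integrable_finsetSum _ fun x _ => integrable_finsetSum _ fun y _ => hint a b x y]
    refine Finset.sum_congr rfl fun a _ => ?_
    rw [integral_finsetSum _ fun b _ =>
      integrable_finsetSum _ fun x _ => integrable_finsetSum _ fun y _ => hint a b x y]
    refine Finset.sum_congr rfl fun b _ => ?_
    rw [integral_finsetSum _ fun x _ => integrable_finsetSum _ fun y _ => hint a b x y]
    refine Finset.sum_congr rfl fun x _ => ?_
    rw [integral_finsetSum _ fun y _ => hint a b x y]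
    refine Finset.sum_congr rfl fun y _ => ?_
    rw [integral_const_mul]
  rw [heq]
  calc _ ≤ ∫ _ω, ε ∂S.μ := by
        refine integral_mono (integrable_finsetSum _ fun a _ => integrable_finsetSum _ fun b _ =>
          integrable_finsetSum _ fun x _ => integrable_finsetSum _ fun y _ => hint a b x y)
          (integrable_const _) fun ω => ?_
        obtain ⟨g, h, hgh⟩ := exists_det_response_ge M (S.p_nonneg ω) (S.q_nonneg ω) (S.p_sum ω)
          (S.q_sum ω)
        exact hgh.trans (hM g h)
    _ = ε := by simp

/-- The factor `δ_{a,k}` leaves only the `k` that Alice outputs, as if she had told it to Bob. -/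
theorem sum_bell_det {n : ℕ} (G : XORGame X Y) (g : X → Fin n × ℤˣ) (h : Y × Fin n → ℤˣ) :
    ∑ x, ∑ y, G.bell n (g x) (h y) x y =
      ∑ x, ∑ y, G.π x y * ((G.f x y * DetStrategy.answer (g, h) x y : ℤˣ) : ℤ) := by
  refine Finset.sum_congr rfl fun x _ => ?_
  rw [Fintype.sum_prod_type]
  refine Finset.sum_congr rfl fun y _ => ?_
  simp [XORGame.bell, XORGame.coeff, DetStrategy.answer, mul_assoc]

theorem abs_pairing_bell_le {n : ℕ} (G : XORGame X Y) {ε : ℝ}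
    (hG : ∀ s : DetStrategy X Y n,
      ∑ x, ∑ y, G.π x y * ((G.f x y * s.answer x y : ℤˣ) : ℤ) ≤ ε)
    {P : Fin n × ℤˣ → ℤˣ → X → Y × Fin n → ℝ}
    (hP : P ∈ classicalSet X (Y × Fin n) (Fin n × ℤˣ) ℤˣ) : |(G.bell n).pairing P| ≤ ε := by
  rw [abs_le']
  refine ⟨pairing_le_of_det _ (fun g h => (sum_bell_det G g h).trans_le (hG (g, h))) hP, ?_⟩
  rw [← pairing_neg]
  refine pairing_le_of_det _ (fun g h => ?_) hP
  -- Flipping Bob's answer negates the score, so the upper bound also bounds the absolute value.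
  have := hG (g, fun y => -h y)
  rw [← sum_bell_det] at this
  simpa [XORGame.bell] using this

theorem pairing_bell {n : ℕ} (G : XORGame X Y) (P : Fin n × ℤˣ → ℤˣ → X → Y × Fin n → ℝ) :
    (G.bell n).pairing P = ∑ x, ∑ y, G.coeff x y *
      ∑ k, ∑ s : ℤˣ, ∑ b : ℤˣ, ((s : ℤ) : ℝ) * ((b : ℤ) : ℝ) * P (k, s) b x (y, k) := by
  have h1 : (G.bell n).pairing P = ∑ k, ∑ s : ℤˣ, ∑ b : ℤˣ, ∑ x, ∑ y, G.coeff x y *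
      (((s : ℤ) : ℝ) * ((b : ℤ) : ℝ) * P (k, s) b x (y, k)) := by
    simp only [BellFunctional.pairing, Fintype.sum_prod_type, XORGame.bell, mul_assoc, ite_mul,
      one_mul, zero_mul, mul_ite, mul_zero, Finset.sum_ite_eq, Finset.mem_univ, if_true]
  simp_rw [h1, Finset.mul_sum]
  refine (Finset.sum_congr rfl fun k _ => (Finset.sum_congr rfl fun s _ =>
    Finset.sum_comm).trans Finset.sum_comm).trans (Finset.sum_comm.trans
    (Finset.sum_congr rfl fun x _ => ?_))
  exact (Finset.sum_congr rfl fun k _ => (Finset.sum_congr rfl fun s _ =>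
    Finset.sum_comm).trans Finset.sum_comm).trans Finset.sum_comm

/-- Each player answers a fair coin off the chosen input, so all other terms average to zero. A
nonzero coefficient then makes the classical value positive, as division by it requires. -/
theorem exists_classical_pairing_bell_eq {n : ℕ} (hn : 0 < n) (G : XORGame X Y) (x₀ : X) (y₀ : Y) :
    ∃ P ∈ classicalSet X (Y × Fin n) (Fin n × ℤˣ) ℤˣ, (G.bell n).pairing P = G.coeff x₀ y₀ := by
  classical
  let u : Prop → ℤˣ → ℝ := fun c s => (1 + if c then ((s : ℤ) : ℝ) else 0) / 2
  have u_nonneg : ∀ c s, 0 ≤ u c s := by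
    intro c s
    rcases Int.units_eq_one_or s with rfl | rfl <;> by_cases hc : c <;> simp [u, hc]
  have u_sum : ∀ c, ∑ s, u c s = 1 := by
    intro c
    by_cases hc : c <;> simp [u, hc]
  have u_mean : ∀ c, ∑ s : ℤˣ, ((s : ℤ) : ℝ) * u c s = if c then 1 else 0 := by
    intro c
    by_cases hc : c <;> simp [u, hc]
  let p : X → Fin n × ℤˣ → ℝ := fun x a => if a.1 = ⟨0, hn⟩ then u (x = x₀) a.2 else 0
  let q : Y × Fin n → ℤˣ → ℝ := fun y b => u (y.1 = y₀) b
  have p_nonneg : ∀ x a, 0 ≤ p x a := fun x a => by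
    simp only [p]; split_ifs; exacts [u_nonneg _ _, le_rfl]
  have p_sum : ∀ x, ∑ a, p x a = 1 := fun x => by
    simpa [p, Fintype.sum_prod_type_right] using u_sum (x = x₀)
  let S : LocalStrategy X (Y × Fin n) (Fin n × ℤˣ) ℤˣ :=
    { Ω := Unit
      μ := Measure.dirac ()
      p := fun _ => p
      q := fun _ => q
      p_meas := fun _ _ => measurable_const
      q_meas := fun _ _ => measurable_const
      p_nonneg := fun _ => p_nonneg
      q_nonneg := fun _ _ _ => u_nonneg _ _
      p_sum := fun _ => p_sum
      q_sum := fun _ _ => u_sum _ }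
  refine ⟨fun a b x y => p x a * q y b, ⟨⟨fun a b x y => mul_nonneg (p_nonneg _ _)
    (u_nonneg _ _), fun x y => ?_⟩, S, fun a b x y => ?_⟩, ?_⟩
  · simp_rw [← Finset.mul_sum, q, u_sum, mul_one, p_sum]
  · simp [S]
  · rw [pairing_bell]
    have h : ∀ x y, ∑ k, ∑ s : ℤˣ, ∑ b : ℤˣ,
        ((s : ℤ) : ℝ) * ((b : ℤ) : ℝ) * (p x (k, s) * q (y, k) b) =
          (if x = x₀ then 1 else 0) * if y = y₀ then 1 else 0 := by
      intro x y
      rw [← u_mean, ← u_mean, Finset.sum_mul_sum, Fintype.sum_eq_single ⟨0, hn⟩]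
      · exact Finset.sum_congr rfl fun s _ => Finset.sum_congr rfl fun b _ => by
          simp [p, q]; ring
      · intro k hk
        simp [p, hk]
    simp_rw [h]
    simp

theorem classicalValue_bell_mem_Ioc {n : ℕ} (hn : 0 < n) (G : XORGame X Y) {ε : ℝ}
    (hG : ∀ s : DetStrategy X Y n,
      ∑ x, ∑ y, G.π x y * ((G.f x y * s.answer x y : ℤˣ) : ℤ) ≤ ε) :
    (G.bell n).classicalValue ∈ Set.Ioc 0 ε := by
  obtain ⟨x₀, y₀, h₀⟩ : ∃ x y, G.π x y ≠ 0 := by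
    by_contra! h
    simpa [h] using G.π_sum
  obtain ⟨P, hP, hval⟩ := exists_classical_pairing_bell_eq hn G x₀ y₀
  have hpos : 0 < |(G.bell n).pairing P| := by
    rw [hval, abs_pos, XORGame.coeff]
    exact mul_ne_zero h₀ (by simp)
  refine ⟨hpos.trans_le (le_csSup ⟨ε, ?_⟩ ⟨P, hP, rfl⟩), Real.sSup_le ?_
    (hpos.le.trans (abs_pairing_bell_le G hG hP))⟩
  all_goals
    rintro _ ⟨Q, hQ, rfl⟩
    exact abs_pairing_bell_le G hG hQ

end ClassicalValue

end OneWay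

/-! ### Correlations of the maximally entangled state -/

namespace OneWay

open Matrix MeasureTheory

section POVM

variable {X Y A B : Type*} [Fintype A] [Fintype B]
  {ι : Type} [Fintype ι] [DecidableEq ι]

omit [DecidableEq ι] in
theorem trace_mul_nonneg {S T : Matrix ι ι ℂ} (hS : S.PosSemidef) (hT : T.PosSemidef) :
    0 ≤ (S * T).trace := by
  obtain ⟨m, v, rfl⟩ := posSemidef_iff_eq_sum_vecMulVec.1 hT
  rw [Matrix.mul_sum, trace_sum]
  refine Finset.sum_nonneg fun i _ => ?_
  rw [Matrix.mul_vecMulVec, trace_vecMulVec, dotProduct_comm]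
  exact hS.dotProduct_mulVec_nonneg _

theorem toEuclideanCLM_isPositive {S : Matrix ι ι ℂ} (hS : S.PosSemidef) :
    (toEuclideanCLM (𝕜 := ℂ) S).IsPositive := by
  rw [← ContinuousLinearMap.isPositive_toLinearMap_iff, coe_toEuclideanCLM_eq_toEuclideanLin,
    Matrix.isPositive_toEuclideanLin_iff]
  exact hS

variable (ι) in
/-- The maximally entangled unit vector in `ℂ^ι ⊗ ℂ^ι`. -/
noncomputable def maxEntangled : EuclideanSpace ℂ ι ⊗[ℂ] EuclideanSpace ℂ ι :=
  ∑ i, EuclideanSpace.single i (((√(Fintype.card ι) : ℝ) : ℂ)⁻¹) ⊗ₜ[ℂ]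
    EuclideanSpace.single i (1 : ℂ)

/-- Only the products `S i j * T i j` survive. The transpose is why Alice later measures with `(σ
x)ᵀ`. -/
theorem inner_maxEntangled (S T : Matrix ι ι ℂ) :
    ⟪maxEntangled ι, TensorProduct.mapL (toEuclideanCLM (𝕜 := ℂ) S) (toEuclideanCLM (𝕜 := ℂ) T)
      (maxEntangled ι)⟫_ℂ = (Fintype.card ι : ℂ)⁻¹ * (Sᵀ * T).trace := by
  have hsq : (((√(Fintype.card ι) : ℝ) : ℂ)⁻¹) * (((√(Fintype.card ι) : ℝ) : ℂ)⁻¹) =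
      (Fintype.card ι : ℂ)⁻¹ := by
    rw [← mul_inv, ← Complex.ofReal_mul, Real.mul_self_sqrt (Nat.cast_nonneg _),
      Complex.ofReal_natCast]
  have hentry : ∀ (S : Matrix ι ι ℂ) i j (c : ℂ), ⟪EuclideanSpace.single i c,
      toEuclideanCLM (𝕜 := ℂ) S (EuclideanSpace.single j c)⟫_ℂ = star c * c * S i j := by
    intro S i j c
    simp [EuclideanSpace.inner_single_left]
    ring
  rw [maxEntangled, map_sum, sum_inner]
  simp_rw [inner_sum, TensorProduct.mapL_tmul, TensorProduct.inner_tmul, hentry]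
  rw [Complex.star_def, map_inv₀, Complex.conj_ofReal, hsq]
  simp only [map_one, one_mul, mul_assoc, ← Finset.mul_sum, Matrix.trace, Matrix.diag,
    Matrix.mul_apply, Matrix.transpose_apply]
  rw [Finset.sum_comm]

/-- The correlations obtained by measuring POVMs on both halves of a maximally entangled state
are quantum. -/
theorem mem_quantumSet_of_povm [Nonempty ι] {E : X → A → Matrix ι ι ℂ} {F : Y → B → Matrix ι ι ℂ}
    (hE : ∀ x a, (E x a).PosSemidef) (hF : ∀ y b, (F y b).PosSemidef)
    (hE1 : ∀ x, ∑ a, E x a = 1) (hF1 : ∀ y, ∑ b, F y b = 1) :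
    (fun a b x y => (Fintype.card ι : ℝ)⁻¹ * ((E x a)ᵀ * F y b).trace.re) ∈
      quantumSet X Y A B := by
  have hcard : (Fintype.card ι : ℝ) ≠ 0 := Nat.cast_ne_zero.2 Fintype.card_ne_zero
  have hnn : ∀ a b x y, 0 ≤ ((E x a)ᵀ * F y b).trace := fun a b x y =>
    trace_mul_nonneg (hE x a).transpose (hF y b)
  refine ⟨⟨fun a b x y => mul_nonneg (by positivity) (Complex.le_def.1 (hnn a b x y)).1,
    fun x y => ?_⟩, ?_⟩
  · have h : ∑ a, ∑ b, ((E x a)ᵀ * F y b).trace = Fintype.card ι := by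
      simp_rw [← trace_sum, ← Matrix.mul_sum, hF1, mul_one, ← transpose_sum, hE1,
        transpose_one, trace_one]
    have h2 := congrArg Complex.re h
    simp only [Complex.re_sum, Complex.natCast_re] at h2
    simp_rw [← Finset.mul_sum, h2]
    exact inv_mul_cancel₀ hcard
  · obtain ⟨w, b, -⟩ := exists_hilbertBasis ℂ
      (HilbertTensor (EuclideanSpace ℂ ι) (EuclideanSpace ℂ ι))
    let φ : HilbertTensor (EuclideanSpace ℂ ι) (EuclideanSpace ℂ ι) := maxEntangled ι
    -- For the pure state `φ` the trace is `⟪φ, (S ⊗ T) φ⟫`, by Parseval in any Hilbert basis.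
    have hop : ∀ S T : Matrix ι ι ℂ,
        HasSum (fun i => ⟪b i, tensorOp (toEuclideanCLM (𝕜 := ℂ) S) (toEuclideanCLM (𝕜 := ℂ) T)
          (InnerProductSpace.rankOne ℂ φ φ (b i))⟫_ℂ)
          ((Fintype.card ι : ℂ)⁻¹ * (Sᵀ * T).trace) := by
      intro S T
      have h := b.hasSum_inner_mul_inner φ
        (tensorOp (toEuclideanCLM (𝕜 := ℂ) S) (toEuclideanCLM (𝕜 := ℂ) T) φ)
      have h2 : ⟪φ, tensorOp (toEuclideanCLM (𝕜 := ℂ) S) (toEuclideanCLM (𝕜 := ℂ) T) φ⟫_ℂ =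
          (Fintype.card ι : ℂ)⁻¹ * (Sᵀ * T).trace := by
        rw [← inner_maxEntangled, tensorOp]
        simp only [φ]
        rw [ContinuousLinearMap.completion_apply_coe, UniformSpace.Completion.inner_coe]
      rw [h2] at h
      refine h.congr_fun fun i => ?_
      rw [InnerProductSpace.rankOne_apply, map_smul, inner_smul_right]
    refine ⟨{ H₁ := EuclideanSpace ℂ ι, H₂ := EuclideanSpace ℂ ι, ι := w, basis := b
              ρ := InnerProductSpace.rankOne ℂ φ φ
              ρ_pos := InnerProductSpace.isPositive_rankOne_self φ
              ρ_trace := ?_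
              E := fun x a => toEuclideanCLM (𝕜 := ℂ) (E x a)
              F := fun y b => toEuclideanCLM (𝕜 := ℂ) (F y b)
              E_pos := fun x a => toEuclideanCLM_isPositive (hE x a)
              F_pos := fun y b => toEuclideanCLM_isPositive (hF y b)
              E_sum := fun x => ?_
              F_sum := fun y => ?_ }, fun a b x y => ?_⟩
    · have h := b.hasSum_inner_mul_inner φ φ
      have h2 : ⟪φ, φ⟫_ℂ = 1 := by
        have h3 := inner_maxEntangled (1 : Matrix ι ι ℂ) 1
        simp only [φ]
        rw [UniformSpace.Completion.inner_coe]
        have hid : TensorProduct.mapL (toEuclideanCLM (𝕜 := ℂ) (1 : Matrix ι ι ℂ))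
            (toEuclideanCLM (𝕜 := ℂ) (1 : Matrix ι ι ℂ)) (maxEntangled ι) = maxEntangled ι := by
          simp [maxEntangled]
        rw [hid] at h3
        rw [h3]
        simp
      rw [h2] at h
      refine h.congr_fun fun i => ?_
      rw [InnerProductSpace.rankOne_apply, inner_smul_right]
    · rw [← map_sum, hE1, map_one]; rfl
    · rw [← map_sum, hF1, map_one]; rfl
    · have h := hop (E x a) (F y b)
      convert h using 1
      obtain ⟨-, him⟩ := Complex.le_def.1 (hnn a b x y)
      apply Complex.ext <;> simp [← him]

end POVM

/-! ### Weyl operators -/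

section Weyl

variable {d : ℕ} [NeZero d]

/-- The Weyl operators `e_j ↦ ψ(k₂ (j + k₁)) e_{j + k₁}` on `ℂ^d`, where `ψ` is the standard
additive character. -/
noncomputable def weyl (k : ZMod d × ZMod d) : Matrix (ZMod d) (ZMod d) ℂ :=
  Matrix.of fun i j => if j = i - k.1 then ZMod.stdAddChar (k.2 * i) else 0

theorem weyl_conj_apply (k : ZMod d × ZMod d) (S : Matrix (ZMod d) (ZMod d) ℂ) (i j : ZMod d) :
    (weyl k * S * (weyl k)ᴴ) i j =
      ZMod.stdAddChar (k.2 * (i - j)) * S (i - k.1) (j - k.1) := by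
  have h : (ZMod.stdAddChar (k.2 * (i - j)) : ℂ) =
      ZMod.stdAddChar (k.2 * i) * (starRingEnd ℂ) (ZMod.stdAddChar (k.2 * j)) := by
    rw [← AddChar.map_neg_eq_conj, ← AddChar.map_add_eq_mul]
    congr 1; ring
  rw [h]
  simp only [Matrix.mul_apply, weyl, of_apply, conjTranspose_apply, ite_mul, zero_mul,
    Finset.sum_ite_eq', Finset.mem_univ, if_true]
  simp [apply_ite]
  ring

theorem weyl_mul_conjTranspose (k : ZMod d × ZMod d) : weyl k * (weyl k)ᴴ = 1 := by
  ext i j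
  have := weyl_conj_apply k 1 i j
  rw [mul_one] at this
  rw [this, one_apply, one_apply]
  by_cases h : i = j <;> simp [h]

/-- Summing over `k.2` kills off-diagonal entries by orthogonality of characters and gives a factor
`d`; summing over `k.1` turns each diagonal entry into the trace. -/
theorem sum_weyl_conj (S : Matrix (ZMod d) (ZMod d) ℂ) :
    ∑ k, weyl k * S * (weyl k)ᴴ = (d * S.trace) • (1 : Matrix (ZMod d) (ZMod d) ℂ) := by
  ext i j
  simp only [Matrix.sum_apply, weyl_conj_apply, Fintype.sum_prod_type]
  simp_rw [← Finset.sum_mul, AddChar.sum_mulShift _ (ZMod.isPrimitive_stdAddChar d), sub_eq_zero]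
  by_cases h : i = j
  · subst h
    simp [← Finset.mul_sum, Matrix.trace]
    left
    exact (Equiv.subLeft i).sum_comp fun j => S j j
  · simp [h]

end Weyl

end OneWay

/-! ### Teleportation and the quantum value -/

namespace OneWay

open Matrix MeasureTheory

section Teleportation

variable {X Y : Type*} [Fintype X] [Fintype Y]

/-- Measurements on a maximally entangled pair which teleport the state `σ x` to Bob, up to the
Weyl operator indexed by Alice's outcome. -/
theorem exists_quantum_pairing_eq_of_zmod {d : ℕ} [NeZero d] (G : XORGame X Y)
    {σ : X → Matrix (ZMod d) (ZMod d) ℂ} {M : Y → ℤˣ → Matrix (ZMod d) (ZMod d) ℂ}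
    (hσ : ∀ x, (σ x).PosSemidef) (hσ1 : ∀ x, (σ x).trace = 1)
    (hM : ∀ y s, (M y s).PosSemidef) (hM1 : ∀ y, ∑ s, M y s = 1) :
    ∃ P ∈ quantumSet X (Y × Fin (d ^ 2)) (Fin (d ^ 2) × ℤˣ) ℤˣ,
      (G.bell (d ^ 2)).pairing P =
        ∑ x, ∑ y, G.coeff x y * ∑ b : ℤˣ, ((b : ℤ) : ℝ) * (M y b * σ x).trace.re := by
  have hd : (d : ℂ) ≠ 0 := Nat.cast_ne_zero.2 (NeZero.ne d)
  have hdR : (d : ℝ) ≠ 0 := Nat.cast_ne_zero.2 (NeZero.ne d)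
  let κ : Fin (d ^ 2) ≃ ZMod d × ZMod d := Fintype.equivOfCardEq (by simp [ZMod.card, sq])
  -- Alice's sign is always `1`. The Weyl sum is `d` times the identity, hence the factor `d⁻¹`.
  let E : X → Fin (d ^ 2) × ℤˣ → Matrix (ZMod d) (ZMod d) ℂ := fun x a =>
    if a.2 = 1 then (d : ℂ)⁻¹ • (weyl (κ a.1) * (σ x)ᵀ * (weyl (κ a.1))ᴴ) else 0
  -- `ᴴᵀ` is entrywise conjugation: outcome `k` leaves Bob with `σ x` rotated by the conjugate Weyl
  -- matrix, so his measurement is rotated alike.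
  let F : Y × Fin (d ^ 2) → ℤˣ → Matrix (ZMod d) (ZMod d) ℂ := fun y b =>
    (weyl (κ y.2))ᴴᵀ * M y.1 b * (weyl (κ y.2))ᴴᵀᴴ
  have hE : ∀ x a, (E x a).PosSemidef := by
    intro x a
    simp only [E]
    split_ifs
    · exact ((hσ x).transpose.mul_mul_conjTranspose_same _).smul
        (inv_nonneg.2 (Nat.cast_nonneg d))
    · exact PosSemidef.zero
  have hE1 : ∀ x, ∑ a, E x a = 1 := by
    intro x
    simp only [E, Fintype.sum_prod_type, Finset.sum_ite_eq', Finset.mem_univ, if_true]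
    rw [← Finset.smul_sum, κ.sum_comp fun k => weyl k * (σ x)ᵀ * (weyl k)ᴴ, sum_weyl_conj,
      trace_transpose, hσ1, mul_one, smul_smul, inv_mul_cancel₀ hd, one_smul]
  have hF : ∀ y b, (F y b).PosSemidef := fun y b => (hM _ _).mul_mul_conjTranspose_same _
  have hV : ∀ k : ZMod d × ZMod d, (weyl k)ᴴᵀᴴ = (weyl k)ᵀ := fun k => by
    ext i j
    simp [conjTranspose_apply]
  have hunit : ∀ k : ZMod d × ZMod d, (weyl k)ᴴᵀ * (weyl k)ᴴᵀᴴ = 1 := by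
    intro k
    rw [hV, ← transpose_mul, weyl_mul_conjTranspose, transpose_one]
  have hF1 : ∀ y, ∑ b, F y b = 1 := by
    intro y
    simp only [F]
    rw [← Matrix.sum_mul, ← Matrix.mul_sum, hM1, mul_one, hunit]
  have htr : ∀ x y k b, ((E x (k, 1))ᵀ * F (y, k) b).trace =
      (d : ℂ)⁻¹ * (M y b * σ x).trace := by
    intro x y k b
    simp only [E, F, if_true, transpose_smul, transpose_mul, transpose_transpose, smul_mul_assoc,
      trace_smul, smul_eq_mul, ← hV]
    have hunit' := mul_eq_one_comm.1 (hunit (κ k))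
    generalize (weyl (κ k))ᴴᵀ = V at hunit'
    congr 1
    calc _ = (V * (σ x * (Vᴴ * V) * M y b) * Vᴴ).trace := by simp only [mul_assoc]
      _ = (M y b * σ x).trace := by
        rw [hunit', mul_one, trace_mul_comm, ← mul_assoc, hunit', one_mul, trace_mul_comm]
  refine ⟨_, mem_quantumSet_of_povm hE hF hE1 hF1, ?_⟩
  rw [pairing_bell]
  refine Finset.sum_congr rfl fun x _ => Finset.sum_congr rfl fun y _ => ?_
  congr 1
  have hneg : ∀ k, E x (k, -1) = 0 := fun k => by simp [E]
  have hre : ∀ z : ℂ, ((d : ℂ)⁻¹ * z).re = (d : ℝ)⁻¹ * z.re := fun z => by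
    rw [← Complex.ofReal_natCast, ← Complex.ofReal_inv, Complex.re_ofReal_mul]
  -- One `d⁻¹` comes from the state and one from the POVM; the `d ^ 2` values of `k` make up for
  -- both.
  have hsum : ∀ k : Fin (d ^ 2), ∑ s : ℤˣ, ∑ b : ℤˣ, ((s : ℤ) : ℝ) * ((b : ℤ) : ℝ) *
      ((Fintype.card (ZMod d) : ℝ)⁻¹ * ((E x (k, s))ᵀ * F (y, k) b).trace.re) =
      ((d : ℝ) ^ 2)⁻¹ * ∑ b : ℤˣ, ((b : ℤ) : ℝ) * (M y b * σ x).trace.re := by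
    intro k
    rw [Fintype.sum_eq_single (1 : ℤˣ)]
    · simp_rw [htr, hre, ZMod.card, Finset.mul_sum]
      refine Finset.sum_congr rfl fun b _ => ?_
      push_cast
      ring
    · intro s hs
      rw [(Int.units_eq_one_or s).resolve_left hs, hneg]
      simp
  rw [Finset.sum_congr rfl fun k _ => hsum k, Finset.sum_const, Finset.card_univ, Fintype.card_fin,
    nsmul_eq_mul, Nat.cast_pow, mul_inv_cancel_left₀ (pow_ne_zero 2 hdR)]

theorem exists_quantum_pairing_eq {d : ℕ} [NeZero d] (G : XORGame X Y)
    {σ : X → Matrix (Fin d) (Fin d) ℂ} {M : Y → ℤˣ → Matrix (Fin d) (Fin d) ℂ}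
    (hσ : ∀ x, (σ x).PosSemidef) (hσ1 : ∀ x, (σ x).trace = 1)
    (hM : ∀ y s, (M y s).PosSemidef) (hM1 : ∀ y, ∑ s, M y s = 1) :
    ∃ P ∈ quantumSet X (Y × Fin (d ^ 2)) (Fin (d ^ 2) × ℤˣ) ℤˣ,
      (G.bell (d ^ 2)).pairing P =
        ∑ x, ∑ y, G.coeff x y * ∑ b : ℤˣ, ((b : ℤ) : ℝ) * (M y b * σ x).trace.re := by
  let e : ZMod d ≃ Fin d := (ZMod.finEquiv d).toEquiv.symm
  have htr : ∀ S : Matrix (Fin d) (Fin d) ℂ, (S.submatrix e e).trace = S.trace := fun S =>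
    e.sum_comp fun i => S i i
  obtain ⟨P, hP, h⟩ := exists_quantum_pairing_eq_of_zmod G
    (σ := fun x => (σ x).submatrix e e) (M := fun y s => (M y s).submatrix e e)
    (fun x => (hσ x).submatrix e) (fun x => (htr _).trans (hσ1 x)) (fun y s => (hM y s).submatrix e)
    (fun y => by
      have := congrArg (fun S => S.submatrix e e) (hM1 y)
      simp only [submatrix_one_equiv] at this
      rw [← this]
      ext i j
      simp [Matrix.sum_apply])
  refine ⟨P, hP, h.trans ?_⟩
  simp_rw [submatrix_mul_equiv, htr]

end Teleportation

/-- Probabilities are at most `1`, so the pairings are bounded by the sum of the `|M a b x y|` and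
the real `sSup` is a true supremum. -/
theorem pairing_le_quantumValue {X Y A B : Type*} [Fintype X] [Fintype Y] [Fintype A] [Fintype B]
    (M : BellFunctional X Y A B) {P : A → B → X → Y → ℝ} (hP : P ∈ quantumSet X Y A B) :
    M.pairing P ≤ M.quantumValue := by
  refine (le_abs_self _).trans (le_csSup ⟨∑ a, ∑ b, ∑ x, ∑ y, |M a b x y|, ?_⟩ ⟨P, hP, rfl⟩)
  rintro _ ⟨Q, ⟨⟨hQ0, hQ1⟩, -⟩, rfl⟩
  have hle : ∀ a b x y, Q a b x y ≤ 1 := fun a b x y => by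
    rw [← hQ1 x y]
    exact (Finset.single_le_sum (fun b _ => hQ0 a b x y) (Finset.mem_univ b)).trans
      (Finset.single_le_sum (f := fun a => ∑ b, Q a b x y)
        (fun a _ => Finset.sum_nonneg fun b _ => hQ0 a b x y) (Finset.mem_univ a))
  refine (Finset.abs_sum_le_sum_abs _ _).trans (Finset.sum_le_sum fun a _ =>
    (Finset.abs_sum_le_sum_abs _ _).trans (Finset.sum_le_sum fun b _ =>
    (Finset.abs_sum_le_sum_abs _ _).trans (Finset.sum_le_sum fun x _ =>
    (Finset.abs_sum_le_sum_abs _ _).trans (Finset.sum_le_sum fun y _ => ?_))))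
  rw [abs_mul, abs_of_nonneg (hQ0 a b x y)]
  exact mul_le_of_le_one_right (abs_nonneg _) (hle a b x y)

/-- A one-way quantum protocol computing `f` with probability larger than `2 / 3` gives a quantum
strategy with value at least `1 / 3`, whatever the distribution of the inputs. -/
theorem one_third_le_quantumValue {X Y : Type*} [Fintype X] [Fintype Y] (G : XORGame X Y) {c : ℕ}
    (Q : QuantumProtocol X Y c) (hQ : ∀ x y, 2 / 3 < Q.outputProb x y (G.f x y)) :
    1 / 3 ≤ (G.bell ((2 ^ c) ^ 2)).quantumValue := by
  let r : X → Y → Q.Λ → ℝ := fun x y l => (Q.meas y l (G.f x y) * Q.state x l).trace.re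
  -- A non-integrable function has integral `0`, which is not above `2 / 3`.
  have hint : ∀ x y, Integrable (r x y) Q.μ := fun x y => by
    by_contra h
    have := hQ x y
    rw [QuantumProtocol.outputProb, integral_undef h] at this
    norm_num at this
  have hterm : ∀ x y, Integrable (fun l => G.π x y * (2 * r x y l - 1)) Q.μ := fun x y =>
    (((hint x y).const_mul 2).sub (integrable_const 1)).const_mul _
  -- With `π` fixed, some value of the shared randomness does at least as well as the average.
  obtain ⟨l, hl⟩ := exists_integral_le (integrable_finsetSum Finset.univ fun x _ =>
    integrable_finsetSum Finset.univ fun y _ => hterm x y)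
  have hbias : ∀ x y, ∑ b : ℤˣ, ((b : ℤ) : ℝ) * (Q.meas y l b * Q.state x l).trace.re =
      ((G.f x y : ℤ) : ℝ) * (2 * r x y l - 1) := by
    intro x y
    have h1 : ∑ b : ℤˣ, (Q.meas y l b * Q.state x l).trace.re = 1 := by
      rw [← Complex.re_sum, ← trace_sum, ← Matrix.sum_mul, Q.meas_sum, one_mul, Q.state_trace,
        Complex.one_re]
    simp only [r]
    rcases Int.units_eq_one_or (G.f x y) with h | h <;> rw [h] <;>
      simp at h1 ⊢ <;> linarith
  obtain ⟨P, hP, hval⟩ := exists_quantum_pairing_eq G (σ := fun x => Q.state x l)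
    (M := fun y s => Q.meas y l s) (fun x => Q.state_pos x l) (fun x => Q.state_trace x l)
    (fun y s => Q.meas_pos y l s) (fun y => Q.meas_sum y l)
  refine le_trans ?_ (pairing_le_quantumValue _ hP)
  have hsq : ∀ s : ℤˣ, ((s : ℤ) : ℝ) * ((s : ℤ) : ℝ) = 1 := fun s => by
    rcases Int.units_eq_one_or s with rfl | rfl <;> simp
  have hval2 : (G.bell ((2 ^ c) ^ 2)).pairing P =
      ∑ x, ∑ y, G.π x y * (2 * r x y l - 1) := by
    rw [hval]
    refine Finset.sum_congr rfl fun x _ => Finset.sum_congr rfl fun y _ => ?_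
    rw [hbias, XORGame.coeff, mul_assoc, ← mul_assoc ((G.f x y : ℤ) : ℝ), hsq, one_mul]
  rw [hval2]
  refine le_trans ?_ hl
  rw [integral_finsetSum _ fun x _ => integrable_finsetSum _ fun y _ => hterm x y]
  calc (1 / 3 : ℝ) = ∑ x, ∑ y, G.π x y * (1 / 3) := by
        simp_rw [← Finset.sum_mul, G.π_sum, one_mul]
    _ ≤ _ := Finset.sum_le_sum fun x _ => by
        rw [integral_finsetSum _ fun y _ => hterm x y]
        refine Finset.sum_le_sum fun y _ => ?_
        rw [integral_const_mul, integral_sub ((hint x y).const_mul 2) (integrable_const 1),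
          integral_const_mul]
        refine mul_le_mul_of_nonneg_left ?_ (G.π_nonneg x y)
        have := hQ x y
        rw [QuantumProtocol.outputProb] at this
        simp only [integral_const, probReal_univ, one_smul]
        simp only [r]
        linarith

end OneWay

/-! ### The main theorem -/

theorem theorem2 {X Y : Type*} [Fintype X] [Fintype Y] (f : X → Y → ℤˣ) (α : ℝ) (hα : 216 < α)
    (hf : α < (OneWay.CC f (2 / 3) : ℝ) / (OneWay.QC f (2 / 3) : ℝ)) :
    ∃ G : OneWay.XORGame X Y, G.f = f ∧
      √α / (6 * √6) ≤
        (G.bell ((2 ^ OneWay.QC f (2 / 3)) ^ 2)).quantumValue /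
          (G.bell ((2 ^ OneWay.QC f (2 / 3)) ^ 2)).classicalValue := by
  classical
  have hα0 : 0 < α := by linarith
  set c := OneWay.QC f (2 / 3) with hc
  -- At `c = 0` the quotient in `hf` would be `0`. As `sInf ∅ = 0` too, `c ≠ 0` guarantees an
  -- optimal quantum protocol.
  have hc0 : c ≠ 0 := by
    intro h
    rw [h, Nat.cast_zero, div_zero] at hf
    linarith
  have hc1 : (1 : ℝ) ≤ c := by exact_mod_cast Nat.one_le_iff_ne_zero.2 hc0
  obtain ⟨Q, hQ⟩ := Nat.sInf_mem (Nat.nonempty_of_sInf_eq_succ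
    (hc.symm.trans (Nat.succ_pred_eq_of_ne_zero hc0).symm))
  rw [lt_div_iff₀ (by linarith)] at hf
  set n := (2 ^ c) ^ 2 with hn
  have hnpos : 0 < n := by positivity
  have : NeZero n := ⟨hnpos.ne'⟩
  set ε : ℝ := 2 * √6 / √α with hε
  have hε0 : 0 < ε := by positivity
  have hε2 : ε ^ 2 = 24 / α := by
    rw [hε, div_pow, mul_pow, Real.sq_sqrt (by norm_num), Real.sq_sqrt hα0.le]
    norm_num
  rcases OneWay.exists_mixed_strategy_or (S := OneWay.DetStrategy X Y n) (I := X × Y)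
    (fun s i => ((f i.1 i.2 * s.answer i.1 i.2 : ℤˣ) : ℤ)) ε with ⟨q, hq, hbias⟩ | ⟨p, hp, hval⟩
  · exfalso
    -- Since `ε² = 24/α`, this asks for `⌊α/3⌋ > α/8`.
    have ht : 3 < (⌊α / 3⌋₊ : ℝ) * ε ^ 2 := by
      rw [hε2, mul_div_assoc', lt_div_iff₀ hα0]
      linarith [Nat.lt_floor_add_one (α / 3)]
    have hCC := OneWay.CC_le_of_mixed_strategy f (b := 2 * c + 1) (t := ⌊α / 3⌋₊)
      (by rw [hn]; ring) hε0 ht hq fun x y => hbias (x, y)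
    have hCC' : (OneWay.CC f (2 / 3) : ℝ) ≤ (2 * c + 1) * ⌊α / 3⌋₊ := by exact_mod_cast hCC
    have hfl : (⌊α / 3⌋₊ : ℝ) ≤ α / 3 := Nat.floor_le (by positivity)
    -- `2c + 1 ≤ 3c` because `c ≥ 1`; the factor `3` cancels the one in `α / 3`.
    have : (2 * c + 1) * (⌊α / 3⌋₊ : ℝ) ≤ (3 * c) * (α / 3) := by
      gcongr
      linarith
    linarith
  · let G : OneWay.XORGame X Y :=
      { f := f
        π := fun x y => p (x, y)
        π_nonneg := fun x y => hp.1 _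
        π_sum := by rw [← Fintype.sum_prod_type']; exact hp.2 }
    refine ⟨G, rfl, ?_⟩
    obtain ⟨hw0, hw1⟩ := OneWay.classicalValue_bell_mem_Ioc hnpos G (ε := ε) fun s => by
      have := (hval s).le
      rwa [Fintype.sum_prod_type] at this
    have hquant := OneWay.one_third_le_quantumValue G Q hQ
    rw [le_div_iff₀ hw0]
    calc √α / (6 * √6) * (G.bell n).classicalValue ≤ √α / (6 * √6) * ε := by gcongr
      _ = 1 / 3 := by
        rw [hε]
        have : √α ≠ 0 := by positivity
        have : √(6 : ℝ) ≠ 0 := by positivity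
        field_simp
        norm_num
      _ ≤ _ := hquant
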